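/- Let $J$ be the James space of all real sequences $x=(x(n))_{n\in\mathbb N}$ with $$\|x\|_J=\sup\Bigl\{\Bigl(\sum_{i=1}^{k}\bigl|\sum_{n\in I_i}x(n)\bigr|^2\Bigr)^{1/2}: I_1,\dots,I_k \text{ disjoint finite intervals of }\mathbb N\Bigr\}<\infty ,$$ with closed unit ball $B_J$, unit vectors $(e_n)$ and dual space $(J^*,\|\cdot\|_*)$. For a non-empty (finite or infinite) interval $I$ of $\mathbb N$ let $I^*\in J^*$ be the functional $I^*(x)=\sum_{n\in I}x(n)$ (the limit of the partial sums, taken in increasing order, if $I$ is infinite). Let $\mathcal D$ be the set of all $\sum_{i=1}^k a_iI_i^*$ with $I_1,\dots,I_k$ disjoint finite intervals of $\mathbb N$ and $\bigl(\sum_{i=1}^k a_i^2\bigr)^{1/2}\le 1$, and let $\mathcal D_1$ be the $w^*$-closure of $\mathcal D$ in $J^*$. Let $F$ be a non-empty finite initial segment of $\mathbb N$ or $F=\mathbb N$, let $(I_i)_{i\in F}$ be non-empty intervals of $\mathbb N$, finite or infinite, such that every element of $I_i$ is smaller than every element of $I_j$ whenever $i<j$ in $F$, and let $(\alpha_i)_{i\in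 F}$ be real numbers with $\sum_{i\in F}\alpha_i^2\le 1$. Let $x^*=\sum_{i\in F}\alpha_iI_i^*\in\mathcal D_1$ (the series converges in the norm of $J^*$). Then $\|x^*\|_*=1$ if and only if $\sum_{i\in F}\alpha_ie_i$ is an extreme point of $B_J$, that is, the series $\sum_{i\in F}\alpha_ie_i$ converges in the norm of $J$ and its sum is an extreme point of $B_J$. -/

import Mathlib

open Filter Topology

noncomputable section

/-! ### The James space `J`

Sequences are indexed by `ℕ = {0, 1, 2, …}`. -/

/-- A finite family of pairwise disjoint bounded intervals of `ℕ`; the pair `(a, b)` stands for the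
interval `[a, b]`. -/
def IntervalFamily : Type :=
  {s : Finset (ℕ × ℕ) // (s : Set (ℕ × ℕ)).PairwiseDisjoint fun p => Finset.Icc p.1 p.2}

/-- The quantity `(∑ᵢ |∑_{k ∈ Iᵢ} x(k)|²)^{1/2}` of a finite family `(Iᵢ)` of disjoint intervals. -/
def familyNorm (x : ℕ → ℝ) (s : IntervalFamily) : ℝ :=
  Real.sqrt (∑ p ∈ s.1, |∑ k ∈ Finset.Icc p.1 p.2, x k| ^ 2)

instance : Nonempty IntervalFamily := ⟨⟨∅, by simp⟩⟩

theorem familyNorm_nonneg (x : ℕ → ℝ) (s : IntervalFamily) : 0 ≤ familyNorm x s :=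
  Real.sqrt_nonneg _

theorem familyNorm_eq (x : ℕ → ℝ) (s : IntervalFamily) : familyNorm x s =
    ‖(WithLp.toLp 2 fun p : s.1 => ∑ k ∈ Finset.Icc p.1.1 p.1.2, x k : EuclideanSpace ℝ s.1)‖ := by
  rw [EuclideanSpace.norm_eq, familyNorm, ← Finset.sum_coe_sort]
  simp

theorem familyNorm_add_le (x y : ℕ → ℝ) (s : IntervalFamily) :
    familyNorm (x + y) s ≤ familyNorm x s + familyNorm y s := by
  simp only [familyNorm_eq]
  refine le_trans (le_of_eq ?_) (norm_add_le _ _)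
  congr 1
  ext p
  simp [Finset.sum_add_distrib]

theorem familyNorm_smul (c : ℝ) (x : ℕ → ℝ) (s : IntervalFamily) :
    familyNorm (c • x) s = |c| * familyNorm x s := by
  simp only [familyNorm_eq]
  rw [← Real.norm_eq_abs, ← norm_smul]
  congr 1
  ext p
  simp [Finset.mul_sum]

theorem familyNorm_zero (s : IntervalFamily) : familyNorm 0 s = 0 := by
  simp [familyNorm]

/-- The real sequences `x` with `sup (∑ᵢ |∑_{k ∈ Iᵢ} x(k)|²)^{1/2} < ∞`, the supremum being taken
over all finite families of disjoint bounded intervals. -/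
def jamesSubmodule : Submodule ℝ (ℕ → ℝ) where
  carrier := {x | BddAbove (Set.range (familyNorm x))}
  zero_mem' := ⟨0, by rintro _ ⟨s, rfl⟩; simp [familyNorm_zero]⟩
  add_mem' := by
    rintro x y ⟨A, hA⟩ ⟨B, hB⟩
    refine ⟨A + B, ?_⟩
    rintro _ ⟨s, rfl⟩
    exact (familyNorm_add_le x y s).trans (add_le_add (hA ⟨s, rfl⟩) (hB ⟨s, rfl⟩))
  smul_mem' := by
    rintro c x ⟨A, hA⟩
    refine ⟨|c| * A, ?_⟩
    rintro _ ⟨s, rfl⟩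
    rw [familyNorm_smul]
    exact mul_le_mul_of_nonneg_left (hA ⟨s, rfl⟩) (abs_nonneg c)

/-- The James space `J`. -/
def James : Type := jamesSubmodule

namespace James

instance : AddCommGroup James := inferInstanceAs (AddCommGroup jamesSubmodule)

instance : Module ℝ James := inferInstanceAs (Module ℝ jamesSubmodule)

instance : CoeFun James fun _ => ℕ → ℝ := ⟨fun x => x.1⟩

instance : Norm James := ⟨fun x => ⨆ s : IntervalFamily, familyNorm x s⟩

theorem norm_def (x : James) : ‖x‖ = ⨆ s : IntervalFamily, familyNorm x s := rfl

theorem familyNorm_le_norm (x : James) (s : IntervalFamily) : familyNorm x s ≤ ‖x‖ :=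
  le_ciSup x.2 s

theorem abs_sum_le_norm (x : James) (a b : ℕ) : |∑ k ∈ Finset.Icc a b, x k| ≤ ‖x‖ := by
  have h := familyNorm_le_norm x ⟨{(a, b)}, by simp⟩
  simpa [familyNorm, Real.sqrt_sq_eq_abs] using h

theorem normCore : NormedSpace.Core ℝ James where
  norm_nonneg x := Real.iSup_nonneg fun s => familyNorm_nonneg _ s
  norm_smul c x := by
    rw [norm_def, norm_def, Real.norm_eq_abs, Real.mul_iSup_of_nonneg (abs_nonneg c)]
    exact congrArg iSup (funext fun s => familyNorm_smul c x s)
  norm_triangle x y := ciSup_le fun s => (familyNorm_add_le x y s).trans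
    (add_le_add (familyNorm_le_norm x s) (familyNorm_le_norm y s))
  norm_eq_zero_iff x := by
    constructor
    · intro h
      refine Subtype.ext (funext fun n => ?_)
      have := abs_sum_le_norm x n n
      rw [h, Finset.Icc_self, Finset.sum_singleton] at this
      exact abs_nonpos_iff.1 this
    · rintro rfl
      rw [norm_def]
      exact (congrArg iSup (funext fun s => familyNorm_zero s)).trans ciSup_const

instance : NormedAddCommGroup James := NormedAddCommGroup.ofCore normCore

instance : NormedSpace ℝ James := NormedSpace.ofCore normCore

theorem single_mem (n : ℕ) : (Pi.single n 1 : ℕ → ℝ) ∈ jamesSubmodule := by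
  refine ⟨1, ?_⟩
  rintro _ ⟨s, rfl⟩
  refine Real.sqrt_le_one.2 ?_
  have h : ∀ p ∈ s.1, |∑ k ∈ Finset.Icc p.1 p.2, (Pi.single n 1 : ℕ → ℝ) k| ^ 2
      = if n ∈ Finset.Icc p.1 p.2 then 1 else 0 := by
    intro p _
    simp only [Pi.single_apply, Finset.sum_ite_eq']
    split_ifs <;> simp
  rw [Finset.sum_congr rfl h, Finset.sum_boole]
  have hc : (s.1.filter fun p => n ∈ Finset.Icc p.1 p.2).card ≤ 1 := by
    refine Finset.card_le_one.2 fun p hp q hq => ?_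
    rw [Finset.mem_filter] at hp hq
    exact s.2.elim_finset (Finset.mem_coe.2 hp.1) (Finset.mem_coe.2 hq.1) n hp.2 hq.2
  exact_mod_cast hc

/-- The unit vector `eₙ`. -/
def e (n : ℕ) : James := ⟨Pi.single n 1, single_mem n⟩

end James

/-! ### Interval functionals -/

/-- A non-empty interval of `ℕ`, bounded or not. -/
structure NatInterval where
  /-- the underlying set -/
  carrier : Set ℕ
  nonempty : carrier.Nonempty
  ordConnected : carrier.OrdConnected

namespace James

theorem exists_Icc (I : NatInterval) (x : ℕ → ℝ) (N M : ℕ) : ∃ a b, N ≤ a ∧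
    ∑ n ∈ Finset.Ico N M, I.carrier.indicator x n = ∑ n ∈ Finset.Icc a b, x n := by
  classical
  have h1 : ∑ n ∈ Finset.Ico N M, I.carrier.indicator x n
      = ∑ n ∈ (Finset.Ico N M).filter (· ∈ I.carrier), x n := by
    rw [Finset.sum_filter]
    exact Finset.sum_congr rfl fun n _ => by simp [Set.indicator_apply]
  rcases ((Finset.Ico N M).filter (· ∈ I.carrier)).eq_empty_or_nonempty with h | h
  · exact ⟨N + 1, N, by omega, by rw [h1, h]; simp⟩
  · have hmin := Finset.min'_mem _ h
    have hmax := Finset.max'_mem _ h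
    refine ⟨Finset.min' _ h, Finset.max' _ h, ?_, ?_⟩
    · simp only [Finset.mem_filter, Finset.mem_Ico] at hmin
      exact hmin.1.1
    · rw [h1]
      refine Finset.sum_congr (Finset.ext fun n => ?_) fun _ _ => rfl
      constructor
      · intro hn
        exact Finset.mem_Icc.2 ⟨Finset.min'_le _ n hn, Finset.le_max' _ n hn⟩
      · intro hn
        rw [Finset.mem_Icc] at hn
        have hm := Finset.mem_filter.1 hmin
        have hM := Finset.mem_filter.1 hmax
        refine Finset.mem_filter.2 ⟨?_, I.ordConnected.out hm.2 hM.2 hn⟩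
        rw [Finset.mem_Ico] at hm hM ⊢
        exact ⟨hm.1.1.trans hn.1, hn.2.trans_lt hM.1.2⟩

theorem tail_lt (x : James) {ε : ℝ} (hε : 0 < ε) :
    ∃ N, ∀ a b, N ≤ a → |∑ k ∈ Finset.Icc a b, x k| < ε := by
  rcases eq_or_ne x 0 with rfl | hx
  · exact ⟨0, fun a b _ => by
      have := abs_sum_le_norm (0 : James) a b
      rw [norm_zero] at this
      exact this.trans_lt hε⟩
  have hpos : 0 < ‖x‖ := norm_pos_iff.2 hx
  have hlt : Real.sqrt (‖x‖ ^ 2 - ε ^ 2) < ‖x‖ := by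
    rw [Real.sqrt_lt' hpos]
    nlinarith
  obtain ⟨s, hs⟩ := exists_lt_of_lt_ciSup hlt
  refine ⟨s.1.sup (fun p => p.1 + p.2) + 1, fun a b ha => ?_⟩
  rcases lt_or_ge b a with hab | hab
  · rw [Finset.Icc_eq_empty (by omega)]
    simpa using hε
  have hbd : ∀ p ∈ s.1, p.1 + p.2 < a := fun p hp =>
    lt_of_lt_of_le (Nat.lt_succ_of_le (Finset.le_sup (f := fun p : ℕ × ℕ => p.1 + p.2) hp)) ha
  have hmem : (a, b) ∉ s.1 := fun h => by
    have := hbd _ h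
    simp only at this
    omega
  have hdisj : ((insert (a, b) s.1 : Finset (ℕ × ℕ)) : Set (ℕ × ℕ)).PairwiseDisjoint
      fun p => Finset.Icc p.1 p.2 := by
    rw [Finset.coe_insert]
    refine s.2.insert fun p hp _ => ?_
    refine Finset.disjoint_left.2 fun n hn hn' => ?_
    rw [Finset.mem_Icc] at hn hn'
    have := hbd p hp
    simp only at hn
    omega
  have h2 := familyNorm_le_norm x ⟨_, hdisj⟩
  have h3 : Real.sqrt (‖x‖ ^ 2 - ε ^ 2) < familyNorm x s := hs
  unfold familyNorm at h2 h3
  simp only at h2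
  rw [Finset.sum_insert hmem, Real.sqrt_le_left hpos.le] at h2
  have h4 : ‖x‖ ^ 2 - ε ^ 2 < ∑ p ∈ s.1, |∑ k ∈ Finset.Icc p.1 p.2, x k| ^ 2 :=
    lt_of_not_ge fun h => h3.not_ge (Real.sqrt_le_sqrt h)
  simp only at h2
  exact lt_of_pow_lt_pow_left₀ 2 hε.le (by linarith)

/-- `lim_N ∑_{n < N, n ∈ I} x(n)`: the sum over an infinite interval converges, in general only
conditionally, for every `x ∈ J`. -/
def intervalSum (I : NatInterval) (x : James) : ℝ :=
  limUnder atTop fun N => ∑ n ∈ Finset.range N, I.carrier.indicator x n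

theorem tendsto_intervalSum (I : NatInterval) (x : James) :
    Tendsto (fun N => ∑ n ∈ Finset.range N, I.carrier.indicator x n) atTop
      (𝓝 (intervalSum I x)) := by
  refine CauchySeq.tendsto_limUnder (Metric.cauchySeq_iff'.2 fun ε hε => ?_)
  obtain ⟨N, hN⟩ := tail_lt x hε
  refine ⟨N, fun M hM => ?_⟩
  obtain ⟨a, b, ha, hab⟩ := exists_Icc I x N M
  rw [Real.dist_eq, ← Finset.sum_Ico_eq_sub _ hM, hab]
  exact hN a b ha

theorem abs_intervalSum_le (I : NatInterval) (x : James) : |intervalSum I x| ≤ ‖x‖ := by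
  refine le_of_tendsto (tendsto_intervalSum I x).abs (Eventually.of_forall fun N => ?_)
  obtain ⟨a, b, -, hab⟩ := exists_Icc I x 0 N
  rw [Finset.range_eq_Ico, hab]
  exact abs_sum_le_norm x a b

/-- The functional `I^* ∈ J^*`, `I^*(x) = ∑_{n ∈ I} x(n)`. -/
def intervalFunctional (I : NatInterval) : StrongDual ℝ James :=
  LinearMap.mkContinuous
    { toFun := intervalSum I
      map_add' := fun x y => by
        refine tendsto_nhds_unique (tendsto_intervalSum I (x + y)) ?_
        refine ((tendsto_intervalSum I x).add (tendsto_intervalSum I y)).congr fun N => ?_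
        rw [← Finset.sum_add_distrib]
        exact Finset.sum_congr rfl fun n _ => (congrFun (Set.indicator_add _ _ _) n).symm
      map_smul' := fun c x => by
        refine tendsto_nhds_unique (tendsto_intervalSum I (c • x)) ?_
        refine ((tendsto_intervalSum I x).const_mul c).congr fun N => ?_
        rw [Finset.mul_sum]
        exact Finset.sum_congr rfl fun n _ =>
          (congrFun (Set.indicator_const_smul I.carrier c (x : ℕ → ℝ)) n).symm }
    1 fun x => by rw [one_mul]; exact abs_intervalSum_le I x

/-- The set `𝓓 ⊆ J^*` of the combinations `∑ᵢ aᵢ Iᵢ^*` of finitely many functionals of disjoint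
finite intervals, with `(∑ᵢ aᵢ²)^{1/2} ≤ 1`. -/
def D : Set (StrongDual ℝ James) :=
  {f | ∃ (k : ℕ) (a : Fin k → ℝ) (I : Fin k → NatInterval),
    (∀ i, (I i).carrier.Finite) ∧ (Pairwise fun i j => Disjoint (I i).carrier (I j).carrier) ∧
    Real.sqrt (∑ i, a i ^ 2) ≤ 1 ∧ f = ∑ i, a i • intervalFunctional (I i)}

/-- The set `𝓓₁`, the closure of `𝓓` in the weak* topology of `J^*`. -/
def D₁ : Set (StrongDual ℝ James) :=
  {f | StrongDual.toWeakDual f ∈ closure (StrongDual.toWeakDual '' D)}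

end James

/-- `x = ∑_{i ∈ F} vᵢ`: the partial sums of the series, taken in the order of `F ⊆ ℕ`, converge in
norm to `x`. -/
def IsSeriesSum {E : Type*} [NormedAddCommGroup E] (F : Set ℕ) (v : ℕ → E) (x : E) : Prop :=
  Tendsto (fun N => ∑ i ∈ Finset.range N, F.indicator v i) atTop (𝓝 x)

end

noncomputable section

namespace James

/-! Write B = ∑ αᵢ². Both sides of the equivalence amount to B = 1 together with ‖∑ αᵢeᵢ‖ ≤ 1.

The extreme points of the ball are its elements of ℓ₂-norm one (`mem_extremePoints_iff`). Such
elements are extreme because ℓ₂ is strictly convex and the ℓ₂-norm is at most the James norm.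
Conversely, let x be extreme. At every cut m, families that do not cross m must almost norm x, since
otherwise a small multiple of e_{m-1} - e_m, invisible to every interval that crosses the cut, could
be added and subtracted. Almost norming families at two consecutive cuts can then be recombined to
isolate the singleton {m} (`headEnergy_succ`), so that the norm of x is reached by singletons alone.

For the functional, completing squares in 2x*(x) = ∑ 2αᵢIᵢ*(x) gives ‖x*‖ ≤ (B + 1)/2, so norm one
forces B = 1. Along x_k in the ball with x*(x_k) → 1, the discarded squares vanish: the sums over Iᵢ
tend to αᵢ and those over the gaps to 0. Hence the αᵢ are limits of sums of x_k over consecutive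
blocks, and summing over blocks does not increase the James norm (`energy_indicator_le`). In the
other direction, placing αᵢ at the least element of Iᵢ gives test vectors in the ball at which x*
takes the values ∑_{i<N} αᵢ² (`sum_sq_le_norm`). -/

/-- The sum `∑ (∑_{k ∈ I} x(k))²` over the intervals `I = [a, b]` with `(a, b) ∈ s`. -/
def energy (x : ℕ → ℝ) (s : Finset (ℕ × ℕ)) : ℝ :=
  ∑ p ∈ s, (∑ k ∈ Finset.Icc p.1 p.2, x k) ^ 2

theorem energy_nonneg (x : ℕ → ℝ) (s : Finset (ℕ × ℕ)) : 0 ≤ energy x s :=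
  Finset.sum_nonneg fun _ _ => sq_nonneg _

theorem familyNorm_eq_sqrt (x : ℕ → ℝ) (s : IntervalFamily) :
    familyNorm x s = Real.sqrt (energy x s.1) := by
  simp [familyNorm, energy]

theorem sq_familyNorm (x : ℕ → ℝ) (s : IntervalFamily) : familyNorm x s ^ 2 = energy x s.1 := by
  rw [familyNorm_eq_sqrt, Real.sq_sqrt (energy_nonneg _ _)]

theorem energy_le_norm_sq (x : James) (s : IntervalFamily) : energy x s.1 ≤ ‖x‖ ^ 2 := by
  rw [← sq_familyNorm]
  exact pow_le_pow_left₀ (familyNorm_nonneg _ _) (familyNorm_le_norm x s) 2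

theorem norm_le_of_energy_le (x : James) {c : ℝ} (hc : 0 ≤ c)
    (h : ∀ s : IntervalFamily, energy x s.1 ≤ c ^ 2) : ‖x‖ ≤ c := by
  refine ciSup_le fun s => ?_
  rw [familyNorm_eq_sqrt]
  exact (Real.sqrt_le_left hc).2 (h s)

theorem mem_of_energy_le {x : ℕ → ℝ} {c : ℝ} (h : ∀ s : IntervalFamily, energy x s.1 ≤ c) :
    x ∈ jamesSubmodule := by
  refine ⟨Real.sqrt c, ?_⟩
  rintro _ ⟨s, rfl⟩
  rw [familyNorm_eq_sqrt]
  exact Real.sqrt_le_sqrt (h s)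

/-! ### Energies of initial and final pieces of a sequence -/

/-- The intervals of the family `s` are non-empty and contained in `[0, m)`. -/
def Below (m : ℕ) (s : IntervalFamily) : Prop := ∀ p ∈ s.1, p.1 ≤ p.2 ∧ p.2 < m

/-- The intervals of the family `s` are non-empty and contained in `[m, ∞)`. -/
def Above (m : ℕ) (s : IntervalFamily) : Prop := ∀ p ∈ s.1, p.1 ≤ p.2 ∧ m ≤ p.1

instance (m : ℕ) : Nonempty {s // Below m s} := ⟨⟨⟨∅, by simp⟩, by simp [Below]⟩⟩

instance (m : ℕ) : Nonempty {s // Above m s} := ⟨⟨⟨∅, by simp⟩, by simp [Above]⟩⟩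

/-- The square of the norm of the restriction of `x` to `[0, m)`. -/
def headEnergy (x : James) (m : ℕ) : ℝ := ⨆ s : {s // Below m s}, energy x s.1.1

/-- The square of the norm of the restriction of `x` to `[m, ∞)`. -/
def tailEnergy (x : James) (m : ℕ) : ℝ := ⨆ s : {s // Above m s}, energy x s.1.1

theorem energy_le_headEnergy (x : James) {m : ℕ} {s : IntervalFamily} (hs : Below m s) :
    energy x s.1 ≤ headEnergy x m :=
  le_ciSup (f := fun s : {s // Below m s} => energy x s.1.1)
    ⟨‖x‖ ^ 2, by rintro _ ⟨s, rfl⟩; exact energy_le_norm_sq x s.1⟩ ⟨s, hs⟩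

theorem energy_le_tailEnergy (x : James) {m : ℕ} {s : IntervalFamily} (hs : Above m s) :
    energy x s.1 ≤ tailEnergy x m :=
  le_ciSup (f := fun s : {s // Above m s} => energy x s.1.1)
    ⟨‖x‖ ^ 2, by rintro _ ⟨s, rfl⟩; exact energy_le_norm_sq x s.1⟩ ⟨s, hs⟩

theorem headEnergy_le {x : James} {m : ℕ} {c : ℝ}
    (h : ∀ s, Below m s → energy x s.1 ≤ c) : headEnergy x m ≤ c :=
  ciSup_le fun s => h s.1 s.2

theorem tailEnergy_le {x : James} {m : ℕ} {c : ℝ}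
    (h : ∀ s, Above m s → energy x s.1 ≤ c) : tailEnergy x m ≤ c :=
  ciSup_le fun s => h s.1 s.2

theorem exists_lt_headEnergy (x : James) (m : ℕ) {c : ℝ} (h : c < headEnergy x m) :
    ∃ s, Below m s ∧ c < energy x s.1 := by
  obtain ⟨s, hs⟩ := exists_lt_of_lt_ciSup h
  exact ⟨s.1, s.2, hs⟩

theorem exists_lt_tailEnergy (x : James) (m : ℕ) {c : ℝ} (h : c < tailEnergy x m) :
    ∃ s, Above m s ∧ c < energy x s.1 := by
  obtain ⟨s, hs⟩ := exists_lt_of_lt_ciSup h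
  exact ⟨s.1, s.2, hs⟩

theorem headEnergy_zero (x : James) : headEnergy x 0 = 0 := by
  refine le_antisymm (headEnergy_le fun s hs => ?_) ?_
  · refine (Finset.sum_eq_zero fun p hp => ?_).le
    exact absurd (hs p hp).2 (by omega)
  · exact (energy_nonneg _ _).trans
      (energy_le_headEnergy x (s := ⟨∅, by simp⟩) (by simp [Below]))

theorem tailEnergy_nonneg (x : James) (m : ℕ) : 0 ≤ tailEnergy x m :=
  (energy_nonneg _ _).trans (energy_le_tailEnergy x (s := ⟨∅, by simp⟩) (by simp [Above]))

theorem tailEnergy_le_norm_sq (x : James) (m : ℕ) : tailEnergy x m ≤ ‖x‖ ^ 2 :=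
  tailEnergy_le fun s _ => energy_le_norm_sq x s

/-- A pair (a, b) with b < a encodes the empty interval and contributes 0. Discarding such pairs is
what lets the remaining intervals be ordered from left to right. -/
theorem energy_filter_nonempty (x : ℕ → ℝ) (s : Finset (ℕ × ℕ)) :
    energy x (s.filter fun p => p.1 ≤ p.2) = energy x s := by
  refine Finset.sum_filter_of_ne fun p _ hp => ?_
  by_contra h
  exact hp (by rw [Finset.Icc_eq_empty h]; simp)

/-- A subfamily of a family of disjoint intervals. -/
def subfamily (s : IntervalFamily) (P : ℕ × ℕ → Prop) [DecidablePred P] : IntervalFamily :=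
  ⟨s.1.filter P, s.2.subset (Finset.coe_subset.2 (Finset.filter_subset _ _))⟩

theorem lt_or_lt_of_mem {s : IntervalFamily} {p q : ℕ × ℕ} (hp : p ∈ s.1) (hq : q ∈ s.1)
    (hpq : p ≠ q) (hp' : p.1 ≤ p.2) (hq' : q.1 ≤ q.2) : p.2 < q.1 ∨ q.2 < p.1 := by
  by_contra! h
  have hd : Disjoint (Finset.Icc p.1 p.2) (Finset.Icc q.1 q.2) := s.2 hp hq hpq
  refine (Finset.disjoint_left.1 hd : ∀ ⦃a⦄, _) (a := max p.1 q.1) ?_ ?_ <;>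
    simp only [Finset.mem_Icc] <;> omega

/-- The union of a family in `[0, m)` and a family in `[m, ∞)`. -/
def join {m : ℕ} {s t : IntervalFamily} (hs : Below m s) (ht : Above m t) : IntervalFamily :=
  ⟨s.1 ∪ t.1, by
    rw [Finset.coe_union, Set.pairwiseDisjoint_union]
    refine ⟨s.2, t.2, fun p hp q hq _ => Finset.disjoint_left.2 fun n hn hn' => ?_⟩
    rw [Finset.mem_Icc] at hn hn'
    have h1 := hs p hp
    have h2 := ht q hq
    omega⟩

theorem energy_join {m : ℕ} {s t : IntervalFamily} (hs : Below m s) (ht : Above m t)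
    (x : ℕ → ℝ) : energy x (join hs ht).1 = energy x s.1 + energy x t.1 := by
  refine Finset.sum_union (Finset.disjoint_left.2 fun p hp hp' => ?_)
  have h1 := hs p hp
  have h2 := ht p hp'
  omega

/-- The family that consists of the interval `[a, b)`. -/
def single (a b : ℕ) : IntervalFamily := ⟨{(a, b - 1)}, by simp⟩

theorem energy_single {a b : ℕ} (hab : a < b) (x : ℕ → ℝ) :
    energy x (single a b).1 = (∑ k ∈ Finset.Ico a b, x k) ^ 2 := by
  have : Finset.Icc a (b - 1) = Finset.Ico a b := by ext; simp; omega
  simp [energy, single, this]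

theorem headEnergy_add_sq_le (x : James) {a b : ℕ} (hab : a ≤ b) :
    headEnergy x a + (∑ k ∈ Finset.Ico a b, x k) ^ 2 ≤ headEnergy x b := by
  rw [← le_sub_iff_add_le]
  refine headEnergy_le fun s hs => ?_
  rw [le_sub_iff_add_le]
  rcases hab.eq_or_lt with rfl | hab
  · simpa using energy_le_headEnergy x hs
  have h : Above a (single a b) := by simp [Above, single]; omega
  rw [← energy_single hab, ← energy_join hs h]
  refine energy_le_headEnergy x fun p hp => ?_
  rcases Finset.mem_union.1 hp with hp | hp
  · have := hs p hp
    omega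
  · obtain rfl : p = (a, b - 1) := by simpa [single] using hp
    simp only
    omega

theorem sq_add_tailEnergy_le (x : James) {a b : ℕ} (hab : a ≤ b) :
    (∑ k ∈ Finset.Ico a b, x k) ^ 2 + tailEnergy x b ≤ tailEnergy x a := by
  rw [← le_sub_iff_add_le']
  refine tailEnergy_le fun s hs => ?_
  rw [le_sub_iff_add_le']
  rcases hab.eq_or_lt with rfl | hab
  · simpa using energy_le_tailEnergy x hs
  have h : Below b (single a b) := by simp [Below, single]; omega
  rw [← energy_single hab, ← energy_join h hs]
  refine energy_le_tailEnergy x fun p hp => ?_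
  rcases Finset.mem_union.1 hp with hp | hp
  · obtain rfl : p = (a, b - 1) := by simpa [single] using hp
    simp only
    omega
  · have := hs p hp
    omega

theorem headEnergy_add_tailEnergy_le (x : James) (m : ℕ) :
    headEnergy x m + tailEnergy x m ≤ ‖x‖ ^ 2 := by
  rw [← le_sub_iff_add_le]
  refine headEnergy_le fun s hs => ?_
  rw [le_sub_comm]
  refine tailEnergy_le fun t ht => ?_
  rw [le_sub_iff_add_le', ← energy_join hs ht]
  exact energy_le_norm_sq x _

/-- A finite family of bounded intervals lies below some m, so the initial pieces exhaust the norm.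
Together with `headEnergy_add_tailEnergy_le` this makes the tails vanish. -/
theorem tendsto_headEnergy (x : James) : Tendsto (headEnergy x) atTop (𝓝 (‖x‖ ^ 2)) := by
  have hmono : Monotone (headEnergy x) := fun a b hab =>
    (le_add_of_nonneg_right (sq_nonneg _)).trans (headEnergy_add_sq_le x hab)
  have hle : ∀ m, headEnergy x m ≤ ‖x‖ ^ 2 := fun m => headEnergy_le fun s _ => energy_le_norm_sq x s
  refine tendsto_order.2 ⟨fun c hc => ?_, fun c hc => Eventually.of_forall fun m => (hle m).trans_lt hc⟩
  obtain ⟨s, hs⟩ : ∃ s : IntervalFamily, c < energy x s.1 := by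
    by_contra! h
    have hc0 : 0 ≤ c := (energy_nonneg _ _).trans (h ⟨∅, by simp⟩)
    have := norm_le_of_energy_le x (Real.sqrt_nonneg c) fun s => by
      rw [Real.sq_sqrt hc0]; exact h s
    have := pow_le_pow_left₀ (norm_nonneg x) this 2
    rw [Real.sq_sqrt hc0] at this
    exact this.not_gt hc
  filter_upwards [eventually_ge_atTop (s.1.sup (fun p => p.2) + 1)] with m hm
  have hb : Below m (subfamily s fun p => p.1 ≤ p.2) := fun p hp => by
    obtain ⟨hp, hp'⟩ := Finset.mem_filter.1 hp
    exact ⟨hp', lt_of_lt_of_le (Nat.lt_succ_of_le (Finset.le_sup (f := fun p : ℕ × ℕ => p.2) hp)) hm⟩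
  refine hs.trans_le ?_
  rw [← energy_filter_nonempty]
  exact energy_le_headEnergy x hb

theorem tendsto_tailEnergy (x : James) : Tendsto (tailEnergy x) atTop (𝓝 0) := by
  refine squeeze_zero (tailEnergy_nonneg x)
    (fun m => le_sub_iff_add_le'.2 (headEnergy_add_tailEnergy_le x m)) ?_
  have h := (tendsto_headEnergy x).const_sub (‖x‖ ^ 2)
  rwa [sub_self] at h

theorem energy_eq_add_of_mem {s : IntervalFamily} {p : ℕ × ℕ} (hp : p ∈ s.1) (x : ℕ → ℝ) :
    energy x s.1 = energy x (subfamily s (· ≠ p)).1 + (∑ k ∈ Finset.Icc p.1 p.2, x k) ^ 2 := by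
  rw [energy, ← Finset.sum_erase_add _ _ hp]
  simp only [energy, subfamily, Finset.filter_ne']

/-- In an almost norming family of [0, m], the interval ending at m, if there is one, is split off
and u is its left end. Otherwise the family already lies in [0, m) and u = m works. -/
theorem exists_headEnergy_succ_le (x : James) (m : ℕ) {ε : ℝ} (hε : 0 < ε) : ∃ u ≤ m,
    headEnergy x (m + 1) - ε ≤ headEnergy x u + (∑ k ∈ Finset.Ico u (m + 1), x k) ^ 2 := by
  obtain ⟨s, hs, hlt⟩ := exists_lt_headEnergy x (m + 1) (sub_lt_self _ hε)
  by_cases h : ∃ p ∈ s.1, p.2 = m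
  · obtain ⟨p, hp, hpm⟩ := h
    have hp' := hs p hp
    refine ⟨p.1, by omega, hlt.le.trans ?_⟩
    have hI : Finset.Icc p.1 p.2 = Finset.Ico p.1 (m + 1) := by ext; simp; omega
    rw [energy_eq_add_of_mem hp, hI]
    gcongr
    refine energy_le_headEnergy x fun q hq => ?_
    obtain ⟨hq, hqp⟩ := Finset.mem_filter.1 hq
    have hq' := hs q hq
    have := lt_or_lt_of_mem hp hq (Ne.symm hqp) hp'.1 hq'.1
    omega
  · push Not at h
    refine ⟨m, le_rfl, hlt.le.trans (le_add_of_le_of_nonneg ?_ (sq_nonneg _))⟩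
    refine energy_le_headEnergy x fun p hp => ?_
    have h1 := hs p hp
    have h2 := h p hp
    omega

theorem exists_tailEnergy_le (x : James) (m : ℕ) {ε : ℝ} (hε : 0 < ε) : ∃ v, m + 1 ≤ v ∧
    tailEnergy x m - ε ≤ (∑ k ∈ Finset.Ico m v, x k) ^ 2 + tailEnergy x v := by
  obtain ⟨s, hs, hlt⟩ := exists_lt_tailEnergy x m (sub_lt_self _ hε)
  by_cases h : ∃ p ∈ s.1, p.1 = m
  · obtain ⟨p, hp, hpm⟩ := h
    have hp' := hs p hp
    refine ⟨p.2 + 1, by omega, hlt.le.trans ?_⟩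
    have hI : Finset.Icc p.1 p.2 = Finset.Ico m (p.2 + 1) := by ext; simp; omega
    rw [energy_eq_add_of_mem hp, hI, add_comm]
    gcongr
    refine energy_le_tailEnergy x fun q hq => ?_
    obtain ⟨hq, hqp⟩ := Finset.mem_filter.1 hq
    have hq' := hs q hq
    have := lt_or_lt_of_mem hp hq (Ne.symm hqp) hp'.1 hq'.1
    omega
  · push Not at h
    refine ⟨m + 1, le_rfl, hlt.le.trans (le_add_of_nonneg_of_le (sq_nonneg _) ?_)⟩
    refine energy_le_tailEnergy x fun p hp => ?_
    have h1 := hs p hp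
    have h2 := h p hp
    omega

/-- If both cuts `m` and `m + 1` are met by almost norming families, then so is the singleton
`{m}`. -/
theorem headEnergy_succ (x : James) (hx : ‖x‖ = 1) (m : ℕ)
    (h0 : headEnergy x m + tailEnergy x m = 1)
    (h1 : headEnergy x (m + 1) + tailEnergy x (m + 1) = 1) :
    headEnergy x (m + 1) = headEnergy x m + x m ^ 2 := by
  have hb := headEnergy_add_sq_le x (Nat.le_succ m)
  simp only [Nat.succ_eq_add_one, Nat.Ico_succ_singleton, Finset.sum_singleton] at hb
  refine (hb.eq_or_lt.resolve_right fun hlt => ?_).symm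
  obtain ⟨δ, hδ⟩ : ∃ δ, δ = headEnergy x (m + 1) - (headEnergy x m + x m ^ 2) := ⟨_, rfl⟩
  have hδ0 : 0 < δ := by linarith
  have hm0 : 0 ≤ headEnergy x m := by
    have := headEnergy_add_sq_le x (Nat.zero_le m)
    rw [headEnergy_zero] at this
    nlinarith
  have ht0 := tailEnergy_nonneg x (m + 1)
  have hδ1 : δ ≤ 1 := by nlinarith
  have hb1 : x m ^ 2 ≤ 1 := by linarith
  -- Only 0 < ε < δ/2 matters below; δ ≤ 1 guarantees it for this choice.
  have hε : 0 < δ ^ 2 / 16 := by positivity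
  obtain ⟨u, hu, hLu⟩ := exists_headEnergy_succ_le x m hε
  obtain ⟨v, hv, hRv⟩ := exists_tailEnergy_le x m hε
  obtain ⟨a, ha⟩ : ∃ a, a = ∑ k ∈ Finset.Ico u m, x k := ⟨_, rfl⟩
  obtain ⟨c, hc⟩ : ∃ c, c = ∑ k ∈ Finset.Ico (m + 1) v, x k := ⟨_, rfl⟩
  have e1 : ∑ k ∈ Finset.Ico u (m + 1), x k = a + x m := by
    rw [Finset.sum_Ico_succ_top hu, ha]
  have e2 : ∑ k ∈ Finset.Ico m v, x k = x m + c := by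
    rw [Finset.sum_eq_sum_Ico_succ_bot (by omega), hc]
  have e3 : ∑ k ∈ Finset.Ico u v, x k = a + x m + c := by
    rw [← Finset.sum_Ico_consecutive _ hu (by omega : m ≤ v), e2, ← ha, add_assoc]
  have k1 := headEnergy_add_sq_le x hu
  have k2 := sq_add_tailEnergy_le x hv
  have k3 := headEnergy_add_sq_le x (by omega : u ≤ v)
  have k4 := headEnergy_add_tailEnergy_le x v
  rw [← ha] at k1
  rw [← hc] at k2
  rw [e3] at k3
  rw [e1] at hLu
  rw [e2] at hRv
  rw [hx] at k4
  -- Put b = x m. Comparing [u, m] with its split at m gives ab > 0, and comparing [m, v) with its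
  -- split at m + 1 gives bc > 0. Merging both into [u, v), which cannot exceed total energy 1,
  -- gives ac < 0. These signs contradict (ab)(bc) = (ac)b².
  have hab : δ - δ ^ 2 / 16 ≤ 2 * (a * x m) := by nlinarith
  have hbc : δ - δ ^ 2 / 16 ≤ 2 * (x m * c) := by nlinarith
  have hac : 2 * (a * c) ≤ δ ^ 2 / 16 + δ ^ 2 / 16 - δ := by nlinarith
  have hδ2 : δ ^ 2 / 16 < δ / 2 := by nlinarith
  have hp : 0 < (a * x m) * (x m * c) := mul_pos (by linarith) (by linarith)
  have : (a * x m) * (x m * c) = (a * c) * x m ^ 2 := by ring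
  rw [this] at hp
  refine hp.not_ge (mul_nonpos_of_nonpos_of_nonneg ?_ (sq_nonneg _))
  linarith
/-! ### Extreme points of the unit ball -/

theorem add_apply (x y : James) (n : ℕ) : (x + y) n = x n + y n := rfl

theorem sub_apply (x y : James) (n : ℕ) : (x - y) n = x n - y n := rfl

theorem smul_apply (c : ℝ) (x : James) (n : ℕ) : (c • x) n = c * x n := rfl

theorem e_apply (m n : ℕ) : e m n = if n = m then 1 else 0 := by
  simp [e, Pi.single_apply]

theorem ext {x y : James} (h : ∀ n, x n = y n) : x = y := Subtype.ext (funext h)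

theorem sum_Icc_e (m : ℕ) (p : ℕ × ℕ) :
    ∑ k ∈ Finset.Icc p.1 p.2, e m k = if m ∈ Finset.Icc p.1 p.2 then 1 else 0 := by
  simp only [e_apply, Finset.sum_ite_eq']

theorem eq_zero_of_mem_extremePoints {x h : James}
    (hx : x ∈ (Metric.closedBall (0 : James) 1).extremePoints ℝ)
    (hp : ‖x + h‖ ≤ 1) (hm : ‖x - h‖ ≤ 1) : h = 0 := by
  have := hx.2 (x₁ := x + h) (by simpa using hp) (x₂ := x - h) (by simpa using hm)
    ⟨1 / 2, 1 / 2, by norm_num, by norm_num, by norm_num, by module⟩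
  simpa using this

theorem norm_eq_one_of_mem_extremePoints {x : James}
    (hx : x ∈ (Metric.closedBall (0 : James) 1).extremePoints ℝ) : ‖x‖ = 1 := by
  have hx1 : ‖x‖ ≤ 1 := by simpa using hx.1
  refine hx1.eq_or_lt.resolve_right fun hlt => ?_
  have he : ‖e 0‖ ≠ 0 := by
    rw [norm_ne_zero_iff]
    intro h
    have h0 : e 0 0 = (0 : James) 0 := by rw [h]
    rw [e_apply] at h0
    exact one_ne_zero h0
  have hn : ‖((1 - ‖x‖) / ‖e 0‖) • e 0‖ = 1 - ‖x‖ := by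
    rw [norm_smul, norm_div, norm_norm, div_mul_cancel₀ _ he, Real.norm_of_nonneg (by linarith)]
  have h0 := eq_zero_of_mem_extremePoints hx (h := ((1 - ‖x‖) / ‖e 0‖) • e 0)
    ((norm_add_le _ _).trans (by linarith)) ((norm_sub_le _ _).trans (by linarith))
  rw [h0, norm_zero] at hn
  linarith

/-- A family none of whose intervals crosses the cut splits into a left and a right part. -/
theorem energy_le_head_add_tail (x : James) (m : ℕ) (s : IntervalFamily)
    (hs : ∀ p ∈ s.1, p.1 ≤ p.2 → p.2 < m ∨ m ≤ p.1) :
    energy x s.1 ≤ headEnergy x m + tailEnergy x m := by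
  rw [← energy_filter_nonempty, energy, ← Finset.sum_filter_add_sum_filter_not _ fun p => p.2 < m]
  refine add_le_add (energy_le_headEnergy x (s := subfamily (subfamily s _) _) ?_)
    (energy_le_tailEnergy x (s := subfamily (subfamily s _) _) ?_)
  · intro p hp
    simp only [subfamily, Finset.mem_filter] at hp
    exact ⟨hp.1.2, hp.2⟩
  · intro p hp
    simp only [subfamily, Finset.mem_filter] at hp
    exact ⟨hp.1.2, (hs p hp.1.1 hp.1.2).resolve_left hp.2⟩

/-- A small multiple of `e m - e (m + 1)` can be added to `x` if no family that cuts between `m`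
and `m + 1` almost norms `x`. -/
theorem norm_add_le_one_of_cut {x h : James} (hx : ‖x‖ ≤ 1) (m : ℕ) {c : ℝ}
    (hh : h = c • (e m - e (m + 1)))
    (hle : Real.sqrt (headEnergy x (m + 1) + tailEnergy x (m + 1)) + ‖h‖ ≤ 1) : ‖x + h‖ ≤ 1 := by
  refine ciSup_le fun s => ?_
  by_cases hs : ∀ p ∈ s.1, p.1 ≤ p.2 → p.2 < m + 1 ∨ m + 1 ≤ p.1
  · refine (familyNorm_add_le x h s).trans (le_trans (add_le_add ?_ (familyNorm_le_norm h s)) hle)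
    rw [familyNorm_eq_sqrt]
    exact Real.sqrt_le_sqrt (energy_le_head_add_tail x _ s hs)
  · push Not at hs
    obtain ⟨q, hq, hq1, hq2, hq3⟩ := hs
    -- The interval q contains both m and m + 1, so by disjointness every other interval misses
    -- both. In each case the two entries of h cancel or are absent.
    have key : familyNorm (x + h) s = familyNorm x s := by
      rw [familyNorm, familyNorm]
      congr 1
      refine Finset.sum_congr rfl fun p hp => ?_
      have : ∑ k ∈ Finset.Icc p.1 p.2, h k = 0 := by
        have h1 : ∑ k ∈ Finset.Icc p.1 p.2, h k = c * (∑ k ∈ Finset.Icc p.1 p.2, e m k -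
            ∑ k ∈ Finset.Icc p.1 p.2, e (m + 1) k) := by
          rw [← Finset.sum_sub_distrib, Finset.mul_sum, hh]
          rfl
        have h2 : m ∈ Finset.Icc p.1 p.2 ↔ m + 1 ∈ Finset.Icc p.1 p.2 := by
          rcases eq_or_ne p q with rfl | hpq
          · simp only [Finset.mem_Icc]; omega
          · simp only [Finset.mem_Icc]
            by_cases hp' : p.1 ≤ p.2
            · have := lt_or_lt_of_mem hp hq hpq hp' hq1
              omega
            · omega
        rw [h1, sum_Icc_e, sum_Icc_e]
        simp only [h2, sub_self, mul_zero]
      have h3 : ∑ k ∈ Finset.Icc p.1 p.2, ((x : ℕ → ℝ) + h) k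
          = ∑ k ∈ Finset.Icc p.1 p.2, x k + ∑ k ∈ Finset.Icc p.1 p.2, h k :=
        Finset.sum_add_distrib
      rw [h3, this, add_zero]
    exact key.le.trans ((familyNorm_le_norm x s).trans hx)

/-- Were the sum smaller than 1, the slack would allow a nonzero perturbation of x in both
directions inside the ball, contradicting extremality. The cut at 0 needs no perturbation, since no
interval crosses it. -/
theorem headEnergy_add_tailEnergy_eq_one {x : James}
    (hx : x ∈ (Metric.closedBall (0 : James) 1).extremePoints ℝ) (m : ℕ) :
    headEnergy x m + tailEnergy x m = 1 := by
  have hn := norm_eq_one_of_mem_extremePoints hx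
  rcases m with _ | m
  · have h1 : 1 ≤ headEnergy x 0 + tailEnergy x 0 := by
      by_contra! hlt
      have h0 : 0 ≤ headEnergy x 0 + tailEnergy x 0 := by
        rw [headEnergy_zero, zero_add]
        exact tailEnergy_nonneg x 0
      have := norm_le_of_energy_le x (Real.sqrt_nonneg (headEnergy x 0 + tailEnergy x 0)) fun s => by
        rw [Real.sq_sqrt h0]
        exact energy_le_head_add_tail x 0 s fun p _ _ => Or.inr (Nat.zero_le _)
      rw [hn, Real.one_le_sqrt] at this
      linarith
    have h2 := headEnergy_add_tailEnergy_le x 0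
    rw [hn] at h2
    linarith
  · have h2 := headEnergy_add_tailEnergy_le x (m + 1)
    rw [hn, one_pow] at h2
    refine h2.eq_or_lt.resolve_right fun hlt => ?_
    have hlt' : Real.sqrt (headEnergy x (m + 1) + tailEnergy x (m + 1)) < 1 := by
      rw [Real.sqrt_lt' one_pos]
      simpa using hlt
    obtain ⟨r, hr⟩ : ∃ r, r = Real.sqrt (headEnergy x (m + 1) + tailEnergy x (m + 1)) := ⟨_, rfl⟩
    rw [← hr] at hlt'
    have hd : ‖e m - e (m + 1)‖ ≠ 0 := by
      rw [norm_ne_zero_iff]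
      intro h
      have h0 : (e m - e (m + 1)) m = (0 : James) m := by rw [h]
      rw [sub_apply, e_apply, e_apply, if_pos rfl, if_neg (by omega), sub_zero] at h0
      exact one_ne_zero h0
    -- Scaled so that the perturbation has norm exactly the slack 1 - r.
    obtain ⟨c, hc⟩ : ∃ c, c = (1 - r) / ‖e m - e (m + 1)‖ := ⟨_, rfl⟩
    have hn : ‖c • (e m - e (m + 1))‖ = 1 - r := by
      rw [hc, norm_smul, norm_div, norm_norm, div_mul_cancel₀ _ hd,
        Real.norm_of_nonneg (by linarith)]
    have hx1 : ‖x‖ ≤ 1 := by simpa using hx.1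
    have h0 := eq_zero_of_mem_extremePoints hx (h := c • (e m - e (m + 1)))
      (norm_add_le_one_of_cut hx1 m rfl (by rw [hn, ← hr]; linarith))
      (by
        rw [sub_eq_add_neg, ← neg_smul]
        refine norm_add_le_one_of_cut hx1 m rfl ?_
        rw [neg_smul, norm_neg, hn, ← hr]
        linarith)
    rw [h0, norm_zero] at hn
    linarith

theorem headEnergy_eq_sum {x : James}
    (hx : x ∈ (Metric.closedBall (0 : James) 1).extremePoints ℝ) (m : ℕ) :
    headEnergy x m = ∑ n ∈ Finset.range m, x n ^ 2 := by
  induction m with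
  | zero => simp [headEnergy_zero]
  | succ m ih =>
    rw [headEnergy_succ x (norm_eq_one_of_mem_extremePoints hx) m
      (headEnergy_add_tailEnergy_eq_one hx m) (headEnergy_add_tailEnergy_eq_one hx (m + 1)), ih,
      Finset.sum_range_succ]

theorem sum_sq_le_norm_sq (x : James) (n : ℕ) : ∑ k ∈ Finset.range n, x k ^ 2 ≤ ‖x‖ ^ 2 := by
  have h := energy_le_norm_sq x ⟨(Finset.range n).image fun k => (k, k), by
    intro p hp q hq hpq
    simp only [Finset.coe_image, Set.mem_image] at hp hq
    obtain ⟨i, -, rfl⟩ := hp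
    obtain ⟨j, -, rfl⟩ := hq
    have hij : i ≠ j := fun h => hpq (by rw [h])
    simpa [Function.onFun] using hij⟩
  rw [energy, Finset.sum_image fun i _ j _ hij => congrArg Prod.fst hij] at h
  simpa using h

/-- The extreme points of the unit ball of `J` are its elements with `ℓ₂`-norm one. -/
theorem mem_extremePoints_iff (x : James) :
    x ∈ (Metric.closedBall (0 : James) 1).extremePoints ℝ ↔
      ‖x‖ ≤ 1 ∧ Tendsto (fun N => ∑ n ∈ Finset.range N, x n ^ 2) atTop (𝓝 1) := by
  constructor
  · intro hx
    refine ⟨by simpa using hx.1, ?_⟩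
    have := tendsto_headEnergy x
    rw [norm_eq_one_of_mem_extremePoints hx, one_pow] at this
    exact this.congr fun N => headEnergy_eq_sum hx N
  · rintro ⟨hx, hlim⟩
    refine ⟨by simpa using hx, ?_⟩
    rintro u hu v hv ⟨a, b, ha, hb, hab, hxab⟩
    have hu1 : ‖u‖ ≤ 1 := by simpa using hu
    have hv1 : ‖v‖ ≤ 1 := by simpa using hv
    -- Variance identity for the convex combination au + bv: the weighted mean of the squares
    -- exceeds the square of the mean by ab(u - v)².
    have hle : ∀ N, a * b * ∑ n ∈ Finset.range N, (u n - v n) ^ 2 ≤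
        1 - ∑ n ∈ Finset.range N, x n ^ 2 := by
      intro N
      have hid : ∑ n ∈ Finset.range N, x n ^ 2 = a * ∑ n ∈ Finset.range N, u n ^ 2 +
          b * ∑ n ∈ Finset.range N, v n ^ 2 - a * b * ∑ n ∈ Finset.range N, (u n - v n) ^ 2 := by
        simp only [Finset.mul_sum]
        rw [← Finset.sum_add_distrib, ← Finset.sum_sub_distrib]
        refine Finset.sum_congr rfl fun n _ => ?_
        have hn : x n = a * u n + b * v n := by rw [← hxab]; rfl
        obtain rfl : b = 1 - a := by linarith
        rw [hn]
        ring
      have h1 : ∑ n ∈ Finset.range N, u n ^ 2 ≤ 1 :=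
        (sum_sq_le_norm_sq u N).trans (pow_le_one₀ (norm_nonneg _) hu1)
      have h2 : ∑ n ∈ Finset.range N, v n ^ 2 ≤ 1 :=
        (sum_sq_le_norm_sq v N).trans (pow_le_one₀ (norm_nonneg _) hv1)
      nlinarith [mul_le_mul_of_nonneg_left h1 ha.le, mul_le_mul_of_nonneg_left h2 hb.le]
    have huv : u = v := by
      refine ext fun n => ?_
      have hn : a * b * (u n - v n) ^ 2 ≤ 0 := by
        refine ge_of_tendsto (by simpa only [sub_self] using hlim.const_sub 1) ?_
        filter_upwards [eventually_gt_atTop n] with N hN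
        refine le_trans ?_ (hle N)
        gcongr
        exact Finset.single_le_sum (f := fun n => (u n - v n) ^ 2) (fun _ _ => sq_nonneg _)
          (Finset.mem_range.2 hN)
      have h3 : (u n - v n) ^ 2 ≤ 0 := by
        by_contra! hpos
        have := mul_pos (mul_pos ha hb) hpos
        linarith
      have := pow_eq_zero_iff (two_ne_zero) |>.1 (le_antisymm h3 (sq_nonneg _))
      linarith
    rw [← hxab, ← huv, ← add_smul, hab, one_smul]
/-! ### Block sums -/

theorem sum_Icc_sub {a b : ℕ} (hab : a ≤ b) (f : ℕ → ℝ) :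
    ∑ i ∈ Finset.Icc a b, (f (i + 1) - f i) = f (b + 1) - f a := by
  have h : Finset.Icc a b = Finset.Ico a (b + 1) := by ext; simp
  rw [h, Finset.sum_Ico_eq_sub _ (by omega), Finset.sum_range_sub, Finset.sum_range_sub,
    sub_sub_sub_cancel_right]

/-- The differences of the partial sums of `x` along a monotone sequence of indices form a sequence
whose norm is not larger than that of `x`. -/
theorem energy_block_le (x : James) {t : ℕ → ℕ} (ht : Monotone t) (s : IntervalFamily) :
    energy (fun i => ∑ k ∈ Finset.range (t (i + 1)), x k - ∑ k ∈ Finset.range (t i), x k) s.1 ≤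
      tailEnergy x (t 0) := by
  -- φ sends an index interval to the union of its blocks. P discards empty index intervals and
  -- empty unions, for which the truncated t (p.2 + 1) - 1 would be meaningless.
  obtain ⟨P, hP⟩ : ∃ P : ℕ × ℕ → Prop, P = fun p => p.1 ≤ p.2 ∧ t p.1 < t (p.2 + 1) := ⟨_, rfl⟩
  obtain ⟨φ, hφ⟩ : ∃ φ : ℕ × ℕ → ℕ × ℕ, φ = fun p => (t p.1, t (p.2 + 1) - 1) := ⟨_, rfl⟩
  classical
  have hsep : ∀ p ∈ s.1.filter P, ∀ q ∈ s.1.filter P, p ≠ q →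
      (φ p).2 < (φ q).1 ∨ (φ q).2 < (φ p).1 := by
    intro p hp q hq hpq
    simp only [Finset.mem_filter, hP] at hp hq
    rw [hφ]
    rcases lt_or_lt_of_mem hp.1 hq.1 hpq hp.2.1 hq.2.1 with h | h
    · have := ht (Nat.succ_le_of_lt h)
      simp only [Nat.succ_eq_add_one] at this ⊢
      omega
    · have := ht (Nat.succ_le_of_lt h)
      simp only [Nat.succ_eq_add_one] at this ⊢
      omega
  have hne : ∀ p ∈ s.1.filter P, (φ p).1 ≤ (φ p).2 := by
    intro p hp
    simp only [Finset.mem_filter, hP] at hp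
    rw [hφ]
    simp only
    omega
  have hinj : Set.InjOn φ (s.1.filter P : Finset (ℕ × ℕ)) := by
    intro p hp q hq hpq
    by_contra hne'
    have h1 := hsep p hp q hq hne'
    have h2 := hne q hq
    rw [hpq] at h1
    omega
  have hdisj : (((s.1.filter P).image φ : Finset (ℕ × ℕ)) : Set (ℕ × ℕ)).PairwiseDisjoint
      fun p => Finset.Icc p.1 p.2 := by
    intro p' hp' q' hq' hpq
    obtain ⟨p, hp, rfl⟩ := Finset.mem_image.1 (Finset.mem_coe.1 hp')
    obtain ⟨q, hq, rfl⟩ := Finset.mem_image.1 (Finset.mem_coe.1 hq')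
    have h1 := hsep p hp q hq fun h => hpq (by rw [h])
    refine Finset.disjoint_left.2 fun n hn hn' => ?_
    simp only [Finset.mem_Icc] at hn hn'
    omega
  have habove : Above (t 0) ⟨_, hdisj⟩ := by
    intro p' hp'
    obtain ⟨p, hp, rfl⟩ := Finset.mem_image.1 hp'
    refine ⟨hne p hp, ?_⟩
    rw [hφ]
    exact ht (Nat.zero_le _)
  refine le_of_eq_of_le ?_ (energy_le_tailEnergy x habove)
  rw [energy, energy, Finset.sum_image hinj]
  have hterm : ∀ p : ℕ × ℕ, p.1 ≤ p.2 → ∑ i ∈ Finset.Icc p.1 p.2,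
      (∑ k ∈ Finset.range (t (i + 1)), x k - ∑ k ∈ Finset.range (t i), x k) =
      ∑ k ∈ Finset.Ico (t p.1) (t (p.2 + 1)), x k := fun p hp => by
    rw [sum_Icc_sub hp fun i => ∑ k ∈ Finset.range (t i), x k,
      Finset.sum_Ico_eq_sub _ (ht (by omega))]
  rw [← Finset.sum_filter_of_ne (p := P)]
  · refine Finset.sum_congr rfl fun p hp => ?_
    have hp' := hne p hp
    simp only [Finset.mem_filter, hP] at hp
    rw [hterm p hp.2.1]
    congr 2
    rw [hφ]
    ext k
    simp only [Finset.mem_Ico, Finset.mem_Icc]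
    omega
  · intro p _ hp
    rw [hP]
    by_contra h
    rw [not_and_or, not_le, not_lt] at h
    rcases le_or_gt p.1 p.2 with h1 | h1
    · rw [hterm p h1, Finset.Ico_eq_empty_of_le (h.resolve_left (by omega))] at hp
      simp at hp
    · rw [Finset.Icc_eq_empty (by omega)] at hp
      simp at hp

theorem sum_apply {ι : Type*} (s : Finset ι) (f : ι → James) (n : ℕ) :
    (∑ i ∈ s, f i) n = ∑ i ∈ s, f i n := by
  classical
  induction s using Finset.induction_on with
  | empty => rfl
  | insert i s hi ih => rw [Finset.sum_insert hi, Finset.sum_insert hi, add_apply, ih]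

/-- `(eₙ)` is a basis of `J`. -/
theorem tendsto_sum_smul_e (x : James) :
    Tendsto (fun N => ∑ n ∈ Finset.range N, x n • e n) atTop (𝓝 x) := by
  rw [tendsto_iff_norm_sub_tendsto_zero]
  refine squeeze_zero (fun _ => norm_nonneg _) (fun N => ?_)
    (by simpa using (tendsto_tailEnergy x).sqrt)
  rw [norm_sub_rev]
  refine norm_le_of_energy_le _ (Real.sqrt_nonneg _) fun s => ?_
  rw [Real.sq_sqrt (tailEnergy_nonneg x N)]
  -- For t i = max i N the block differences are the coordinates of x from N on, and 0 before.
  have h := energy_block_le x (t := fun i => max i N) (fun i j hij => max_le_max_right N hij) s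
  simp only [Nat.zero_le, max_eq_right] at h
  refine le_of_eq_of_le (congrArg (energy · s.1) (funext fun k => ?_)) h
  simp only [sub_apply, sum_apply, smul_apply, e_apply, mul_ite, mul_one, mul_zero,
    Finset.sum_ite_eq, Finset.mem_range]
  split_ifs with hk
  · rw [max_eq_right (by omega), max_eq_right (by omega), sub_self, sub_self]
  · rw [max_eq_left (by omega), max_eq_left (by omega), Finset.sum_range_succ]
    ring

/-- Moving coordinates to new positions in order inserts zeros or merges neighbours, so the result
is a sequence of block sums of y and `energy_block_le` applies. -/
theorem norm_sum_smul_e_le (y : James) {A : Set ℕ} (hA : IsLowerSet A) {n : ℕ → ℕ}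
    (hn : MonotoneOn n A) (hy : ∀ i ∉ A, y i = 0) (N : ℕ) :
    ‖∑ i ∈ Finset.range N, y i • e (n i)‖ ≤ ‖y‖ := by
  classical
  -- The indices whose new position is below k form an initial segment; its length τ k serves as the
  -- k-th block boundary.
  have hex : ∀ k, ∃ m, ∀ i, i < m ↔ i < N ∧ i ∈ A ∧ n i < k := by
    intro k
    have hne : {i | ¬(i < N ∧ i ∈ A ∧ n i < k)}.Nonempty := ⟨N, fun h => h.1.false⟩
    refine ⟨sInf {i | ¬(i < N ∧ i ∈ A ∧ n i < k)}, fun i => ⟨fun h => ?_, fun h => ?_⟩⟩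
    · exact not_not.1 (Nat.notMem_of_lt_sInf h)
    · refine not_le.1 fun hle => Nat.sInf_mem hne ⟨hle.trans_lt h.1, hA hle h.2.1, ?_⟩
      exact (hn (hA hle h.2.1) h.2.1 hle).trans_lt h.2.2
  choose τ hτ using hex
  have hmono : Monotone τ := by
    intro k l hkl
    refine le_of_forall_lt fun i hi => ?_
    rw [hτ] at hi ⊢
    exact ⟨hi.1, hi.2.1, hi.2.2.trans_le hkl⟩
  have hsum : ∀ k, ∑ i ∈ Finset.range (τ k), y i =
      ∑ i ∈ Finset.range N, if n i < k then y i else 0 := by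
    intro k
    rw [← Finset.sum_filter]
    refine Finset.sum_subset (fun i hi => ?_) fun i hi hi' => ?_
    · rw [Finset.mem_range, hτ] at hi
      exact Finset.mem_filter.2 ⟨Finset.mem_range.2 hi.1, hi.2.2⟩
    · rw [Finset.mem_filter, Finset.mem_range] at hi
      rw [Finset.mem_range, hτ] at hi'
      exact hy i fun h => hi' ⟨hi.1, h, hi.2⟩
  refine norm_le_of_energy_le _ (norm_nonneg _) fun s => ?_
  refine le_of_eq_of_le (congrArg (energy · s.1) (funext fun k => ?_))
    ((energy_block_le y hmono s).trans (tailEnergy_le_norm_sq y _))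
  rw [hsum, hsum, ← Finset.sum_sub_distrib, sum_apply]
  refine Finset.sum_congr rfl fun i _ => ?_
  rw [smul_apply, e_apply]
  rcases lt_trichotomy (n i) k with h | h | h
  · rw [if_neg (by omega), if_pos (by omega), if_pos h]; ring
  · rw [if_pos h.symm, if_pos (by omega), if_neg (by omega)]; ring
  · rw [if_neg (by omega), if_neg (by omega), if_neg (by omega)]; ring

/-! ### Interval functionals as differences of partial sums -/

/-- The sum of the `x n` with `n < t`, where `t` may be infinite. -/
def partialSum (x : James) (t : ℕ∞) : ℝ :=
  limUnder atTop fun M : ℕ => ∑ k ∈ Finset.range (min t M).toNat, x k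

theorem tendsto_partialSum (x : James) (t : ℕ∞) :
    Tendsto (fun M : ℕ => ∑ k ∈ Finset.range (min t M).toNat, x k) atTop (𝓝 (partialSum x t)) := by
  refine tendsto_nhds_limUnder ?_
  induction t using ENat.recTopCoe with
  | top =>
    refine ⟨_, (tendsto_intervalSum ⟨Set.univ, Set.univ_nonempty, Set.ordConnected_univ⟩ x).congr
      fun M => ?_⟩
    simp
  | coe t =>
    refine ⟨∑ k ∈ Finset.range t, x k, tendsto_const_nhds.congr' ?_⟩
    filter_upwards [eventually_ge_atTop t] with M hM
    rw [min_eq_left (by exact_mod_cast hM), ENat.toNat_natCast]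

/-- Truncating the boundaries at M reduces to finite blocks; then M → ∞. -/
theorem energy_partialSum_le (x : James) {t : ℕ → ℕ∞} (ht : Monotone t) (s : IntervalFamily) :
    energy (fun i => partialSum x (t (i + 1)) - partialSum x (t i)) s.1 ≤ ‖x‖ ^ 2 := by
  have hlim : Tendsto (fun M : ℕ => energy (fun i =>
      ∑ k ∈ Finset.range (min (t (i + 1)) M).toNat, x k -
        ∑ k ∈ Finset.range (min (t i) M).toNat, x k) s.1) atTop
      (𝓝 (energy (fun i => partialSum x (t (i + 1)) - partialSum x (t i)) s.1)) :=
    tendsto_finsetSum _ fun p _ => (tendsto_finsetSum _ fun i _ =>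
      (tendsto_partialSum x _).sub (tendsto_partialSum x _)).pow 2
  refine le_of_tendsto hlim (Eventually.of_forall fun M => ?_)
  refine (energy_block_le x (t := fun i => (min (t i) (M : ℕ∞)).toNat) (fun i j hij => ?_) s).trans
    (tailEnergy_le_norm_sq x _)
  exact ENat.toNat_le_toNat (min_le_min_right _ (ht hij))
    ((min_le_right _ _).trans_lt (ENat.natCast_lt_top M)).ne

theorem sum_sq_partialSum_le (x : James) {t : ℕ → ℕ∞} (ht : Monotone t) (n : ℕ) :
    ∑ i ∈ Finset.range n, (partialSum x (t (i + 1)) - partialSum x (t i)) ^ 2 ≤ ‖x‖ ^ 2 := by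
  have hmem := mem_of_energy_le (energy_partialSum_le x ht)
  refine (sum_sq_le_norm_sq ⟨_, hmem⟩ n).trans (pow_le_pow_left₀ (norm_nonneg _) ?_ 2)
  exact norm_le_of_energy_le _ (norm_nonneg _) (energy_partialSum_le x ht)

end James

/-! ### Ends of an interval -/

namespace NatInterval

/-- The least element of the interval. -/
def lower (I : NatInterval) : ℕ := sInf I.carrier

/-- The least upper bound of the numbers `n + 1` with `n` in the interval. -/
def upper (I : NatInterval) : ℕ∞ := ⨆ n ∈ I.carrier, ((n + 1 : ℕ) : ℕ∞)

theorem lower_mem (I : NatInterval) : I.lower ∈ I.carrier := Nat.sInf_mem I.nonempty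

theorem mem_iff (I : NatInterval) (n : ℕ) : n ∈ I.carrier ↔ I.lower ≤ n ∧ (n : ℕ∞) < I.upper := by
  constructor
  · intro h
    refine ⟨Nat.sInf_le h, lt_of_lt_of_le ?_ (le_iSup₂ (f := fun n _ => ((n + 1 : ℕ) : ℕ∞)) n h)⟩
    exact_mod_cast Nat.lt_succ_self n
  · rintro ⟨h1, h2⟩
    obtain ⟨m, hm⟩ := lt_iSup_iff.1 h2
    obtain ⟨hmI, hm⟩ := lt_iSup_iff.1 hm
    have : n < m + 1 := by exact_mod_cast hm
    exact I.ordConnected.out I.lower_mem hmI ⟨h1, by omega⟩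

theorem lower_le_upper (I : NatInterval) : (I.lower : ℕ∞) ≤ I.upper :=
  ((I.mem_iff _).1 I.lower_mem).2.le

theorem upper_le_lower {I K : NatInterval} (h : ∀ m ∈ I.carrier, ∀ n ∈ K.carrier, m < n) :
    I.upper ≤ K.lower :=
  iSup₂_le fun n hn => by exact_mod_cast Nat.succ_le_of_lt (h n hn _ K.lower_mem)

end NatInterval

namespace James

theorem lt_toNat_min (t : ℕ∞) (M n : ℕ) : n < (min t M).toNat ↔ (n : ℕ∞) < t ∧ n < M := by
  have h : min t (M : ℕ∞) ≠ ⊤ := ((min_le_right _ _).trans_lt (ENat.natCast_lt_top M)).ne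
  rw [← Nat.cast_lt (α := ℕ∞), ENat.natCast_toNat h, lt_min_iff, Nat.cast_lt]

theorem intervalFunctional_apply (I : NatInterval) (x : James) :
    intervalFunctional I x = partialSum x I.upper - partialSum x I.lower := by
  refine tendsto_nhds_unique (tendsto_intervalSum I x) ?_
  refine ((tendsto_partialSum x _).sub (tendsto_partialSum x _)).congr fun M => ?_
  classical
  have hle : (min (I.lower : ℕ∞) M).toNat ≤ (min I.upper M).toNat :=
    ENat.toNat_le_toNat (min_le_min_right _ I.lower_le_upper)
      ((min_le_right _ _).trans_lt (ENat.natCast_lt_top M)).ne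
  rw [← Finset.sum_Ico_eq_sub _ hle]
  simp only [Set.indicator_apply]
  rw [← Finset.sum_filter]
  refine Finset.sum_congr (Finset.ext fun n => ?_) fun _ _ => rfl
  rw [Finset.mem_filter, Finset.mem_range, Finset.mem_Ico, lt_toNat_min, I.mem_iff,
    ← not_lt, lt_toNat_min, Nat.cast_lt]
  by_cases h : n < M <;> simp [h, and_comm]

theorem intervalFunctional_e (I : NatInterval) (n : ℕ) [Decidable (n ∈ I.carrier)] :
    intervalFunctional I (e n) = if n ∈ I.carrier then 1 else 0 := by
  refine tendsto_nhds_unique (tendsto_intervalSum I (e n)) (tendsto_const_nhds.congr' ?_)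
  filter_upwards [eventually_gt_atTop n] with M hM
  rw [Finset.sum_eq_single n]
  · simp [Set.indicator_apply, e_apply]
  · intro k _ hk
    simp [e_apply, hk]
  · intro h
    exact absurd (Finset.mem_range.2 hM) h

/-! ### Series of functionals of successive intervals -/

theorem sum_range_two_mul (f : ℕ → ℝ) (n : ℕ) : ∑ j ∈ Finset.range (2 * n), f j =
    ∑ i ∈ Finset.range n, (f (2 * i) + f (2 * i + 1)) := by
  induction n with
  | zero => simp
  | succ n ih => rw [mul_add, mul_one, Finset.sum_range_succ, Finset.sum_range_succ, ih,
      Finset.sum_range_succ, add_assoc]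

/-- The sequence a₀ ≤ b₀ ≤ a₁ ≤ b₁ ≤ … is one monotone sequence of boundaries, so the intervals and
the gaps between them are controlled at once. -/
theorem sum_sq_interlaced_le (x : James) {a b : ℕ → ℕ∞} (hab : ∀ i, a i ≤ b i)
    (hba : ∀ i, b i ≤ a (i + 1)) (n : ℕ) :
    ∑ i ∈ Finset.range n, ((partialSum x (b i) - partialSum x (a i)) ^ 2 +
      (partialSum x (a (i + 1)) - partialSum x (b i)) ^ 2) ≤ ‖x‖ ^ 2 := by
  obtain ⟨t, ht⟩ : ∃ t : ℕ → ℕ∞, t = fun j => if j % 2 = 0 then a (j / 2) else b (j / 2) :=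
    ⟨_, rfl⟩
  have h0 : ∀ i, t (2 * i) = a i := fun i => by
    rw [ht]
    simp only
    rw [if_pos (by omega), show 2 * i / 2 = i by omega]
  have h1 : ∀ i, t (2 * i + 1) = b i := fun i => by
    rw [ht]
    simp only
    rw [if_neg (by omega), show (2 * i + 1) / 2 = i by omega]
  have hmono : Monotone t := by
    refine monotone_nat_of_le_succ fun j => ?_
    obtain ⟨i, rfl | rfl⟩ : ∃ i, j = 2 * i ∨ j = 2 * i + 1 := ⟨j / 2, by omega⟩
    · rw [h0, h1]
      exact hab i
    · rw [h1, show 2 * i + 1 + 1 = 2 * (i + 1) by ring, h0]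
      exact hba i
  have h := sum_sq_partialSum_le x hmono (2 * n)
  rw [sum_range_two_mul] at h
  refine le_of_eq_of_le (Finset.sum_congr rfl fun i _ => ?_) h
  rw [h0, h1, show 2 * i + 1 + 1 = 2 * (i + 1) by ring, h0]

open Classical in
/-- The left end of `I i`, or `∞` if there is no `i`-th interval. -/
def leftEnd (F : Set ℕ) (I : ℕ → NatInterval) (i : ℕ) : ℕ∞ := if i ∈ F then (I i).lower else ⊤

open Classical in
/-- The right end of `I i`, or `∞` if there is no `i`-th interval. -/
def rightEnd (F : Set ℕ) (I : ℕ → NatInterval) (i : ℕ) : ℕ∞ := if i ∈ F then (I i).upper else ⊤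

section Series

variable {F : Set ℕ} {I : ℕ → NatInterval} {α : ℕ → ℝ} {xs : StrongDual ℝ James}

theorem leftEnd_le_rightEnd (F : Set ℕ) (I : ℕ → NatInterval) (i : ℕ) :
    leftEnd F I i ≤ rightEnd F I i := by
  unfold leftEnd rightEnd
  split_ifs
  · exact (I i).lower_le_upper
  · exact le_rfl

theorem rightEnd_le_leftEnd (hF : IsLowerSet F)
    (hI : ∀ i ∈ F, ∀ j ∈ F, i < j → ∀ m ∈ (I i).carrier, ∀ n ∈ (I j).carrier, m < n) (i : ℕ) :
    rightEnd F I i ≤ leftEnd F I (i + 1) := by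
  unfold leftEnd rightEnd
  by_cases h : i + 1 ∈ F
  · have hi : i ∈ F := hF (Nat.le_succ i) h
    rw [if_pos h, if_pos hi]
    exact NatInterval.upper_le_lower (hI i hi _ h (Nat.lt_succ_self i))
  · rw [if_neg h]
    exact le_top

/-! ### Upper bound for the functional and its near-equality case -/

theorem tendsto_apply (hxs : IsSeriesSum F (fun i => α i • intervalFunctional (I i)) xs)
    (x : James) : Tendsto (fun N => ∑ i ∈ Finset.range N, F.indicator α i *
      (partialSum x (rightEnd F I i) - partialSum x (leftEnd F I i))) atTop (𝓝 (xs x)) := by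
  have h : Tendsto _ _ _ := ((ContinuousLinearMap.apply ℝ ℝ x).continuous.tendsto xs).comp hxs
  refine h.congr fun N => ?_
  rw [Function.comp_apply, ContinuousLinearMap.apply_apply, _root_.sum_apply]
  refine Finset.sum_congr rfl fun i _ => ?_
  by_cases hi : i ∈ F
  · rw [Set.indicator_of_mem hi, Set.indicator_of_mem hi, leftEnd, rightEnd, if_pos hi, if_pos hi,
      ← intervalFunctional_apply]
    rfl
  · rw [Set.indicator_of_notMem hi, Set.indicator_of_notMem hi, zero_mul]
    rfl

/-- Expand the squares: the sums over intervals and gaps have total square at most 1. -/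
theorem sum_sq_sub_le (hF : IsLowerSet F)
    (hI : ∀ i ∈ F, ∀ j ∈ F, i < j → ∀ m ∈ (I i).carrier, ∀ n ∈ (I j).carrier, m < n)
    (β : ℕ → ℝ) {x : James} (hx : ‖x‖ ≤ 1) (N : ℕ) :
    ∑ i ∈ Finset.range N, ((β i -
        (partialSum x (rightEnd F I i) - partialSum x (leftEnd F I i))) ^ 2 +
      (partialSum x (leftEnd F I (i + 1)) - partialSum x (rightEnd F I i)) ^ 2) ≤
    ∑ i ∈ Finset.range N, β i ^ 2 + 1 - 2 * ∑ i ∈ Finset.range N, β i *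
      (partialSum x (rightEnd F I i) - partialSum x (leftEnd F I i)) := by
  have h := (sum_sq_interlaced_le x (leftEnd_le_rightEnd F I) (rightEnd_le_leftEnd hF hI) N).trans
    (pow_le_one₀ (norm_nonneg _) hx)
  rw [add_sub_right_comm]
  refine le_of_eq_of_le ?_ (add_le_add_right h _)
  rw [Finset.mul_sum, ← Finset.sum_sub_distrib, ← Finset.sum_add_distrib]
  exact Finset.sum_congr rfl fun i _ => by ring

/-- Stability estimate: if xs x is close to (B + 1)/2, then each interval sum of x is close to its
coefficient and each gap sum is close to 0. -/
theorem two_mul_apply_le (hF : IsLowerSet F)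
    (hI : ∀ i ∈ F, ∀ j ∈ F, i < j → ∀ m ∈ (I i).carrier, ∀ n ∈ (I j).carrier, m < n)
    (hxs : IsSeriesSum F (fun i => α i • intervalFunctional (I i)) xs) {B : ℝ}
    (hB : Tendsto (fun N => ∑ i ∈ Finset.range N, F.indicator α i ^ 2) atTop (𝓝 B))
    {x : James} (hx : ‖x‖ ≤ 1) (n : ℕ) :
    (F.indicator α n - (partialSum x (rightEnd F I n) - partialSum x (leftEnd F I n))) ^ 2 +
      (partialSum x (leftEnd F I (n + 1)) - partialSum x (rightEnd F I n)) ^ 2 ≤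
      B + 1 - 2 * xs x := by
  refine ge_of_tendsto ((hB.add_const 1).sub ((tendsto_apply hxs x).const_mul 2)) ?_
  filter_upwards [eventually_gt_atTop n] with N hN
  refine le_trans ?_ (sum_sq_sub_le hF hI _ hx N)
  exact Finset.single_le_sum (f := fun i => (F.indicator α i -
    (partialSum x (rightEnd F I i) - partialSum x (leftEnd F I i))) ^ 2 +
      (partialSum x (leftEnd F I (i + 1)) - partialSum x (rightEnd F I i)) ^ 2)
    (fun i _ => add_nonneg (sq_nonneg _) (sq_nonneg _)) (Finset.mem_range.2 hN)

theorem apply_le (hF : IsLowerSet F)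
    (hI : ∀ i ∈ F, ∀ j ∈ F, i < j → ∀ m ∈ (I i).carrier, ∀ n ∈ (I j).carrier, m < n)
    (hxs : IsSeriesSum F (fun i => α i • intervalFunctional (I i)) xs) {B : ℝ}
    (hB : Tendsto (fun N => ∑ i ∈ Finset.range N, F.indicator α i ^ 2) atTop (𝓝 B))
    {x : James} (hx : ‖x‖ ≤ 1) : xs x ≤ (B + 1) / 2 := by
  have := two_mul_apply_le hF hI hxs hB hx 0
  nlinarith

theorem norm_le_half (hF : IsLowerSet F)
    (hI : ∀ i ∈ F, ∀ j ∈ F, i < j → ∀ m ∈ (I i).carrier, ∀ n ∈ (I j).carrier, m < n)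
    (hxs : IsSeriesSum F (fun i => α i • intervalFunctional (I i)) xs) {B : ℝ}
    (hB : Tendsto (fun N => ∑ i ∈ Finset.range N, F.indicator α i ^ 2) atTop (𝓝 B)) :
    ‖xs‖ ≤ (B + 1) / 2 := by
  by_contra! hlt
  obtain ⟨x, hx, hlt⟩ := xs.exists_lt_apply_of_lt_opNorm hlt
  rw [Real.norm_eq_abs, lt_abs] at hlt
  rcases hlt with h | h
  · exact h.not_ge (apply_le hF hI hxs hB hx.le)
  · rw [← map_neg] at h
    exact h.not_ge (apply_le hF hI hxs hB (by rw [norm_neg]; exact hx.le))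

theorem exists_tendsto_apply (hxs : ‖xs‖ = 1) :
    ∃ x : ℕ → James, (∀ k, ‖x k‖ ≤ 1) ∧ Tendsto (fun k => xs (x k)) atTop (𝓝 1) := by
  have h : ∀ k : ℕ, ∃ x : James, ‖x‖ ≤ 1 ∧ 1 - 1 / ((k : ℝ) + 1) < xs x := by
    intro k
    obtain ⟨x, hx, hlt⟩ := xs.exists_lt_apply_of_lt_opNorm (r := 1 - 1 / ((k : ℝ) + 1))
      (by rw [hxs]; exact sub_lt_self _ (by positivity))
    rw [Real.norm_eq_abs, lt_abs] at hlt
    rcases hlt with h | h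
    · exact ⟨x, hx.le, h⟩
    · exact ⟨-x, by rw [norm_neg]; exact hx.le, by rwa [map_neg]⟩
  choose x hx hlt using h
  refine ⟨x, hx, tendsto_of_tendsto_of_tendsto_of_le_of_le ?_ tendsto_const_nhds
    (fun k => (hlt k).le) fun k => ?_⟩
  · simpa using (tendsto_one_div_add_atTop_nhds_zero_nat (𝕜 := ℝ)).const_sub 1
  · have := xs.le_of_opNorm_le hxs.le (x k)
    rw [one_mul] at this
    exact (le_abs_self _).trans (this.trans (hx k))

theorem energy_indicator_le (hF : IsLowerSet F)
    (hI : ∀ i ∈ F, ∀ j ∈ F, i < j → ∀ m ∈ (I i).carrier, ∀ n ∈ (I j).carrier, m < n)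
    (hxs : IsSeriesSum F (fun i => α i • intervalFunctional (I i)) xs)
    (hB : Tendsto (fun N => ∑ i ∈ Finset.range N, F.indicator α i ^ 2) atTop (𝓝 1))
    (hn : ‖xs‖ = 1) (s : IntervalFamily) : energy (F.indicator α) s.1 ≤ 1 := by
  obtain ⟨x, hx, hlim⟩ := exists_tendsto_apply hn
  have hmono : Monotone (leftEnd F I) := monotone_nat_of_le_succ fun i =>
    (leftEnd_le_rightEnd F I i).trans (rightEnd_le_leftEnd hF hI i)
  -- The block from one left end to the next is an interval plus the following gap. Its error is w -
  -- u, and (w - u)² ≤ 2(u² + w²) explains the factor 2 under the root.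
  have hcoord : ∀ i, Tendsto (fun k => partialSum (x k) (leftEnd F I (i + 1)) -
      partialSum (x k) (leftEnd F I i)) atTop (𝓝 (F.indicator α i)) := by
    intro i
    rw [tendsto_iff_norm_sub_tendsto_zero]
    have h0 : Tendsto (fun k => Real.sqrt (2 * (1 + 1 - 2 * xs (x k)))) atTop (𝓝 0) := by
      have := (((hlim.const_mul 2).const_sub (1 + 1)).const_mul 2).sqrt
      norm_num at this ⊢
      exact this
    refine squeeze_zero (fun _ => norm_nonneg _) (fun k => ?_) h0
    refine Real.abs_le_sqrt ?_
    have := two_mul_apply_le hF hI hxs hB (hx k) i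
    obtain ⟨u, hu⟩ : ∃ u, u = F.indicator α i -
      (partialSum (x k) (rightEnd F I i) - partialSum (x k) (leftEnd F I i)) := ⟨_, rfl⟩
    obtain ⟨w, hw⟩ : ∃ w, w = partialSum (x k) (leftEnd F I (i + 1)) -
      partialSum (x k) (rightEnd F I i) := ⟨_, rfl⟩
    rw [← hu, ← hw] at this
    have e1 : partialSum (x k) (leftEnd F I (i + 1)) - partialSum (x k) (leftEnd F I i) -
        F.indicator α i = w - u := by rw [hu, hw]; ring
    rw [e1]
    nlinarith [sq_nonneg (w + u)]
  refine le_of_tendsto (tendsto_finsetSum _ fun p _ => (tendsto_finsetSum _ fun i _ =>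
    hcoord i).pow 2) (Eventually.of_forall fun k => ?_)
  exact (energy_partialSum_le (x k) hmono s).trans (pow_le_one₀ (norm_nonneg _) (hx k))

/-! ### Lower bound by test vectors -/

theorem apply_e_lower
    (hI : ∀ i ∈ F, ∀ j ∈ F, i < j → ∀ m ∈ (I i).carrier, ∀ n ∈ (I j).carrier, m < n)
    (hxs : IsSeriesSum F (fun i => α i • intervalFunctional (I i)) xs) {i : ℕ} (hi : i ∈ F) :
    xs (e (I i).lower) = α i := by
  classical
  have h : Tendsto _ _ _ :=
    ((ContinuousLinearMap.apply ℝ ℝ (e (I i).lower)).continuous.tendsto xs).comp hxs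
  refine tendsto_nhds_unique h (tendsto_const_nhds.congr' ?_)
  filter_upwards [eventually_gt_atTop i] with N hN
  rw [Function.comp_apply, ContinuousLinearMap.apply_apply, _root_.sum_apply, Finset.sum_eq_single i]
  · rw [Set.indicator_of_mem hi, _root_.smul_apply, intervalFunctional_e,
      if_pos (I i).lower_mem, smul_eq_mul, mul_one]
  · intro j _ hj
    by_cases hjF : j ∈ F
    · have hnot : (I i).lower ∉ (I j).carrier := by
        intro hmem
        rcases hj.lt_or_gt with h | h
        · exact (hI j hjF i hi h _ hmem _ (I i).lower_mem).false
        · exact (hI i hi j hjF h _ (I i).lower_mem _ hmem).false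
      rw [Set.indicator_of_mem hjF, _root_.smul_apply, intervalFunctional_e,
        if_neg hnot, smul_zero]
    · rw [Set.indicator_of_notMem hjF]
      rfl
  · intro h
    exact absurd (Finset.mem_range.2 hN) h

theorem sum_sq_le_norm (hF : IsLowerSet F)
    (hI : ∀ i ∈ F, ∀ j ∈ F, i < j → ∀ m ∈ (I i).carrier, ∀ n ∈ (I j).carrier, m < n)
    (hxs : IsSeriesSum F (fun i => α i • intervalFunctional (I i)) xs) {y : James}
    (hy : ‖y‖ ≤ 1) (hyα : ∀ i, y i = F.indicator α i) (N : ℕ) :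
    ∑ i ∈ Finset.range N, y i ^ 2 ≤ ‖xs‖ := by
  have hmono : MonotoneOn (fun i => (I i).lower) F := fun i hi j hj hij => by
    rcases hij.eq_or_lt with rfl | h
    · exact le_rfl
    · exact (hI i hi j hj h _ (I i).lower_mem _ (I j).lower_mem).le
  have hn := (norm_sum_smul_e_le y hF hmono
    (fun i hi => by rw [hyα, Set.indicator_of_notMem hi]) N).trans hy
  have heq : xs (∑ i ∈ Finset.range N, y i • e (I i).lower) = ∑ i ∈ Finset.range N, y i ^ 2 := by
    rw [map_sum]
    refine Finset.sum_congr rfl fun i _ => ?_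
    rw [map_smul, smul_eq_mul, hyα]
    by_cases hi : i ∈ F
    · rw [apply_e_lower hI hxs hi, Set.indicator_of_mem hi, sq]
    · rw [Set.indicator_of_notMem hi]
      ring
  rw [← heq]
  exact (le_abs_self _).trans ((xs.le_opNorm _).trans (mul_le_of_le_one_right (norm_nonneg _) hn))

theorem indicator_smul_e (F : Set ℕ) (α : ℕ → ℝ) (i : ℕ) :
    F.indicator (fun i => α i • e i) i = F.indicator α i • e i := by
  by_cases hi : i ∈ F
  · rw [Set.indicator_of_mem hi, Set.indicator_of_mem hi]
  · rw [Set.indicator_of_notMem hi, Set.indicator_of_notMem hi, zero_smul]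

/-- Since (eₙ) is a basis of J, norm convergence is automatic once the coordinates belong to an
element of J. -/
theorem isSeriesSum_smul_e_iff (x : James) :
    IsSeriesSum F (fun i => α i • e i) x ↔ ∀ n, x n = F.indicator α n := by
  unfold IsSeriesSum
  simp only [indicator_smul_e]
  constructor
  · intro h n
    have h1 := tendsto_iff_norm_sub_tendsto_zero.1 h
    have h2 : |F.indicator α n - x n| ≤ 0 := by
      refine ge_of_tendsto h1 ?_
      filter_upwards [eventually_gt_atTop n] with N hN
      refine le_of_eq_of_le ?_ (abs_sum_le_norm _ n n)
      rw [Finset.Icc_self, Finset.sum_singleton, sub_apply, sum_apply]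
      simp only [smul_apply, e_apply, mul_ite, mul_one, mul_zero]
      rw [Finset.sum_ite_eq, if_pos (Finset.mem_range.2 hN)]
    linarith [abs_nonpos_iff.1 h2]
  · intro h
    simpa only [h] using tendsto_sum_smul_e x

end Series

end James

end

theorem mainTheorem8 (F : Set ℕ) (hF : F.Nonempty) (hFl : IsLowerSet F)
    (I : ℕ → NatInterval)
    (hI : ∀ i ∈ F, ∀ j ∈ F, i < j → ∀ m ∈ (I i).carrier, ∀ n ∈ (I j).carrier, m < n)
    (α : ℕ → ℝ) (hα : Summable fun i : F => α i ^ 2) (hα_le : ∑' i : F, α i ^ 2 ≤ 1)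
    (xs : StrongDual ℝ James)
    (hxs : IsSeriesSum F (fun i => α i • James.intervalFunctional (I i)) xs)
    (hD : xs ∈ James.D₁) :
    ‖xs‖ = 1 ↔
      ∃ x : James, IsSeriesSum F (fun i => α i • James.e i) x ∧
        x ∈ (Metric.closedBall (0 : James) 1).extremePoints ℝ := by
  have hB : Tendsto (fun N => ∑ i ∈ Finset.range N, F.indicator α i ^ 2) atTop
      (𝓝 (∑' i : F, α i ^ 2)) := by
    refine ((hasSum_subtype_iff_indicator (f := fun i => α i ^ 2)).1
      hα.hasSum).tendsto_sum_nat.congr fun N => Finset.sum_congr rfl fun i _ => ?_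
    by_cases hi : i ∈ F <;> simp [hi]
  have hle := James.norm_le_half hFl hI hxs hB
  constructor
  · intro hn
    rw [hn] at hle
    -- ‖xs‖ = 1 ≤ (B + 1)/2 gives B ≥ 1, and B ≤ 1 is assumed.
    rw [show ∑' i : F, α i ^ 2 = 1 by linarith] at hB
    have hen := James.energy_indicator_le hFl hI hxs hB hn
    refine ⟨⟨F.indicator α, James.mem_of_energy_le hen⟩,
      (James.isSeriesSum_smul_e_iff _).2 fun _ => rfl, ?_⟩
    exact (James.mem_extremePoints_iff _).2
      ⟨James.norm_le_of_energy_le _ zero_le_one fun s => by simpa using hen s, hB⟩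
  · rintro ⟨y, hy, hext⟩
    rw [James.isSeriesSum_smul_e_iff] at hy
    obtain ⟨hy1, hlim⟩ := (James.mem_extremePoints_iff y).1 hext
    exact le_antisymm (by linarith)
      (le_of_tendsto hlim (Eventually.of_forall (James.sum_sq_le_norm hFl hI hxs hy1 hy)))
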